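/- **Theorem (upper bound of the log-likelihood ratio under under-fitting).** Let $K_0$ and $K$ be fixed integers with $1\le K<K_0$. For every $K'$ let $\mathbb B_{K'}$ be the set of symmetric $K'\times K'$ matrices with entries in $(0,1)$. For each $N\in\mathbb N$ let $g^*_N\in[K_0]^N$ be a deterministic label vector and let $B^*=\rho_N\widetilde B^*\in\mathbb B_{K_0}$, where $\widetilde B^*\in\mathbb B_{K_0}$ does not depend on $N$ and $\widetilde B^*_{kl}<\widetilde B^*_{kk}$ for all $k\ne l$. Assume that 1. $\rho_N\to0$ and $\rho_N N/\log N\to\infty$; 2. there is a constant $c>0$ with $\min_{1\le k\le K_0}\#\{i: g^*_{N,i}=k\}\ge cN$ for all large $N$. Let $A$ be generated from $\mathrm{SBM}_{K_0}(g^*_N,B^*)$: $A$ is a random symmetric $N\times N$ matrix with zero diagonal and entries in $\{0,1\}$, whose entries $A_{ij}$, $i<j$, are independent Bernoulli variables with $\mathbb E(A_{ij})=B^*_{g^*_{N,i}g^*_{N,j}}$. Let $\mathcal S\subseteq[N]$ be a simple random sample (without replacement, independent of $A$) of $n\le N$ nodes, where $n=\Omega(\log N/\rho_N)$, i.e. $n\ge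 c'\log N/\rho_N$ for all large $N$, with a constant $c'>0$. Let $$E=\{(i,j):i,j\in\mathcal S,\ i<j\}\cup\{(i,j):i\notin\mathcal S,\ j\in\mathcal S\},\qquad M=|E|=Nn-\tfrac{n(n+1)}2 .$$ For $g\in[K']^N$ and $B\in\mathbb B_{K'}$ the log-likelihood of the subsampled adjacency matrix $A^{\mathcal S}=(A_{ij})_{i\in[N],j\in\mathcal S}$ is $$\log f(A^{\mathcal S}\mid g,B)=\sum_{1\le k\le l\le K'}\bigl\{o_{kl,g}\log B_{kl}+(n_{kl,g}-o_{kl,g})\log(1-B_{kl})\bigr\},$$ where $n_{kl,g}$ is the number of pairs $(i,j)\in E$ with $\{g_i,g_j\}=\{k,l\}$ and $o_{kl,g}$ is the sum of $A_{ij}$ over these pairs. Let $\mathcal C(A^{\mathcal S},K)$ be the set of all $g\in[K]^N$ such that, for every $i\notin\mathcal S$, the label $g_i$ maximizes $k\mapsto\sum_{j\in\mathcal S}A_{ij}\mathbb I(g_j=k)$ (the labels of the nodes in $\mathcal S$ are arbitrary, and any maximizer is allowed in case of ties). Put $$L_{K,K_0}=\max_{g\in\mathcal C(A^{\mathcal S},K)}\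 \sup_{B\in\mathbb B_K}\log f(A^{\mathcal S}\mid g,B)-\log f(A^{\mathcal S}\mid g^*_N,B^*).$$ Then $L_{K,K_0}=-\Omega_P(\rho_NM)$: there is a constant $C>0$ such that $$P\bigl(L_{K,K_0}\le -C\rho_NM\bigr)\to1\qquad(N\to\infty).$$ -/

import Mathlib

open MeasureTheory ProbabilityTheory Filter Topology Finset

noncomputable section

namespace SubsampledSBM

/-- The connectivity matrices of a `K`-block model: symmetric matrices with entries in `(0, 1)`. -/
def connMatrices (K : ℕ) : Set (Matrix (Fin K) (Fin K) ℝ) :=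
  {B | B.IsSymm ∧ ∀ k l, 0 < B k l ∧ B k l < 1}

/-- Size of the `k`-th community of the label vector `g`. -/
def communitySize {N K : ℕ} (g : Fin N → Fin K) (k : Fin K) : ℕ :=
  (univ.filter fun i => g i = k).card

/-- The random adjacency matrix `A` is generated from the stochastic block model with label vector
`g` and connectivity matrix `B`: it is symmetric with zero diagonal and entries in `{0, 1}`, and the
entries above the diagonal are independent, the `(i, j)` entry being Bernoulli with success
probability `B (g i) (g j)`. -/
structure IsSBM {Ω : Type*} [MeasurableSpace Ω] (μ : Measure Ω) {N K : ℕ}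
    (A : Ω → Matrix (Fin N) (Fin N) ℝ) (g : Fin N → Fin K) (B : Matrix (Fin K) (Fin K) ℝ) :
    Prop where
  conn : B ∈ connMatrices K
  symm : ∀ ω, (A ω).IsSymm
  diag : ∀ ω i, A ω i i = 0
  zero_or_one : ∀ ω i j, A ω i j = 0 ∨ A ω i j = 1
  measurable : ∀ i j, Measurable fun ω => A ω i j
  indep : iIndepFun
    (fun (p : {p : Fin N × Fin N // p.1 < p.2}) (ω : Ω) => A ω p.1.1 p.1.2) μ
  prob : ∀ i j, i < j → μ {ω | A ω i j = 1} = ENNReal.ofReal (B (g i) (g j))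

/-- The random set `S` is a simple random sample (without replacement) of `n` of the `N` nodes:
it is uniformly distributed on the `n`-element subsets. -/
structure IsSimpleRandomSample {Ω : Type*} [MeasurableSpace Ω] (μ : Measure Ω) {N : ℕ}
    (S : Ω → Finset (Fin N)) (n : ℕ) : Prop where
  measurable : Measurable S
  card : ∀ ω, (S ω).card = n
  prob : ∀ T : Finset (Fin N), T.card = n → μ {ω | S ω = T} = ((N.choose n : ℕ) : ENNReal)⁻¹

/-- The node pairs of the subsample: pairs `i < j` of two selected nodes, and pairs `(i, j)` with
`i` not selected and `j` selected. Every unordered pair that meets `S` occurs exactly once. -/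
def pairs {N : ℕ} (S : Finset (Fin N)) : Finset (Fin N × Fin N) :=
  (univ.filter fun p => p.1 ∈ S ∧ p.2 ∈ S ∧ p.1 < p.2) ∪
    (univ.filter fun p => p.1 ∉ S ∧ p.2 ∈ S)

/-- The number `M = N n - n (n + 1) / 2` of node pairs of a subsample of size `n`. -/
def numPairs (N n : ℕ) : ℝ := (N : ℝ) * n - (n : ℝ) * (n + 1) / 2

/-- The sampled node pairs between the clusters `k` and `l` of the label vector `g`
(pairs are undirected: one end lies in cluster `k`, the other one in cluster `l`). -/
def blockPairs {N K : ℕ} (S : Finset (Fin N)) (g : Fin N → Fin K) (k l : Fin K) :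
    Finset (Fin N × Fin N) :=
  (pairs S).filter fun p => (g p.1 = k ∧ g p.2 = l) ∨ (g p.1 = l ∧ g p.2 = k)

/-- The number `o_{kl}` of observed connections between the clusters `k` and `l`. -/
def obsCount {N K : ℕ} (A : Matrix (Fin N) (Fin N) ℝ) (S : Finset (Fin N)) (g : Fin N → Fin K)
    (k l : Fin K) : ℝ :=
  ∑ p ∈ blockPairs S g k l, A p.1 p.2

/-- The maximal possible number `n_{kl}` of connections between the clusters `k` and `l`. -/
def maxCount {N K : ℕ} (S : Finset (Fin N)) (g : Fin N → Fin K) (k l : Fin K) : ℝ :=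
  ((blockPairs S g k l).card : ℝ)

/-- The log-likelihood `log f(A^S | g, B)` of the subsampled adjacency matrix. -/
def logLik {N K : ℕ} (A : Matrix (Fin N) (Fin N) ℝ) (S : Finset (Fin N)) (g : Fin N → Fin K)
    (B : Matrix (Fin K) (Fin K) ℝ) : ℝ :=
  ∑ k, ∑ l ∈ univ.filter (fun l => k ≤ l),
    (obsCount A S g k l * Real.log (B k l) +
      (maxCount S g k l - obsCount A S g k l) * Real.log (1 - B k l))

/-- The number of connections of the node `i` to the selected nodes with label `k`. -/
def linksTo {N K : ℕ} (A : Matrix (Fin N) (Fin N) ℝ) (S : Finset (Fin N)) (g : Fin N → Fin K)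
    (i : Fin N) (k : Fin K) : ℝ :=
  ∑ j ∈ S.filter (fun j => g j = k), A i j

/-- The candidate label vectors `C(A^S, K)`: the selected nodes are labelled arbitrarily, and every
other node gets a label `k` that maximizes the number of its connections to the selected nodes with
label `k`. Every maximizer is allowed when there are several. -/
def candidates {N : ℕ} (A : Matrix (Fin N) (Fin N) ℝ) (S : Finset (Fin N)) (K : ℕ) :
    Set (Fin N → Fin K) :=
  {g | ∀ i, i ∉ S → ∀ k, linksTo A S g i k ≤ linksTo A S g i (g i)}

/-- The log-likelihood ratio `L_{K, K₀}`: the maximum over the candidate label vectors `g` of the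
supremum over the connectivity matrices `B` of `log f(A^S | g, B)`, minus the log-likelihood at
the true parameters `gs`, `Bs`. -/
def logLikRatio {N K₀ : ℕ} (A : Matrix (Fin N) (Fin N) ℝ) (S : Finset (Fin N)) (K : ℕ)
    (gs : Fin N → Fin K₀) (Bs : Matrix (Fin K₀) (Fin K₀) ℝ) : ℝ :=
  (⨆ g : candidates A S K, ⨆ B : connMatrices K, logLik A S g.1 B.1) - logLik A S gs Bs

end SubsampledSBM

end

noncomputable section

namespace SubsampledSBM

section

/-! ### Blocks that mix two communities -/

/-! With fewer clusters than communities, the pigeonhole principle forces some cluster to contain a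
fixed fraction of the sampled nodes of two different communities. A symmetric matrix that is
constant on cluster blocks has one value where the truth has two, so its squared distance to the
true matrix, measured in square roots of probabilities (Hellinger distance), is at least of order `ρ
N n` (`le_sum_pairs_sq_sub`).

For fixed labels and probabilities, the expected square root of the likelihood ratio is at most `exp
(-d / 2)`, where `d` is this distance, and Markov's inequality gives an exponential tail
(`IsSBM.measure_le_prod_sqrtRatio_le`). The supremum over `B` is bounded by the likelihood at the
block frequencies, which are ratios of integers at most `N ^ 2`. A union bound over node samples,
label vectors and such ratios therefore costs only `exp (O(N))`
(`IsSBM.measure_exists_lt_logLikRatio_le`). Since `ρ n ≥ c' log N → ∞`, the exponent `ρ N n`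
dominates this cost. Chebyshev's inequality shows that the random sample contains enough nodes of
every community with probability tending to one, and `M ≤ N n` turns the rate into `ρ M`. -/

lemma mem_pairs {N : ℕ} {S : Finset (Fin N)} {p : Fin N × Fin N} :
    p ∈ pairs S ↔ (p.1 ∈ S ∧ p.2 ∈ S ∧ p.1 < p.2) ∨ (p.1 ∉ S ∧ p.2 ∈ S) := by
  simp [pairs]

/-- Every ordered pair of distinct nodes that ends in `S` is an element of `pairs S` or the swap of
one, hence the factor 2. -/
lemma sum_erase_le_two_mul_sum_pairs {N : ℕ} {R X S : Finset (Fin N)} (hX : X ⊆ S)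
    {φ : Fin N → Fin N → ℝ} (hsymm : ∀ i j, φ i j = φ j i) (hφ : ∀ i j, 0 ≤ φ i j) :
    ∑ i ∈ R, ∑ j ∈ X.erase i, φ i j ≤ 2 * ∑ p ∈ pairs S, φ p.1 p.2 := by
  classical
  have hsub : (R ×ˢ X).filter (fun p => p.2 ≠ p.1) ⊆
      pairs S ∪ (pairs S).image Prod.swap := by
    rintro ⟨i, j⟩ hp
    simp only [mem_filter, mem_product] at hp
    obtain ⟨⟨-, hj⟩, hne⟩ := hp
    have hjS := hX hj
    simp only [mem_union, mem_image, Prod.exists, Prod.swap_prod_mk, mem_pairs, Prod.mk.injEq]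
    by_cases hi : i ∈ S
    · rcases lt_or_gt_of_ne hne with h | h
      · exact Or.inr ⟨j, i, Or.inl ⟨hjS, hi, h⟩, rfl, rfl⟩
      · exact Or.inl (Or.inl ⟨hi, hjS, h⟩)
    · exact Or.inl (Or.inr ⟨hi, hjS⟩)
  have hlhs : ∑ i ∈ R, ∑ j ∈ X.erase i, φ i j
      = ∑ p ∈ (R ×ˢ X).filter (fun p => p.2 ≠ p.1), φ p.1 p.2 := by
    rw [sum_filter, sum_product]
    refine sum_congr rfl fun i _ => ?_
    rw [← sum_filter]
    congr 1
    ext j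
    simp [and_comm]
  have himg : ∑ p ∈ (pairs S).image Prod.swap, φ p.1 p.2 = ∑ p ∈ pairs S, φ p.1 p.2 := by
    rw [sum_image (Prod.swap_injective.injOn)]
    exact sum_congr rfl fun p _ => hsymm _ _
  have hui := sum_union_inter (s₁ := pairs S) (s₂ := (pairs S).image Prod.swap)
    (f := fun p => φ p.1 p.2)
  have hnn : 0 ≤ ∑ p ∈ pairs S ∩ (pairs S).image Prod.swap, φ p.1 p.2 :=
    sum_nonneg fun p _ => hφ _ _
  have := sum_le_sum_of_subset_of_nonneg hsub (f := fun p => φ p.1 p.2) fun p _ _ => hφ _ _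
  rw [hlhs]
  linarith

lemma exists_card_le_mul_card_fiber {α : Type*} {K : ℕ} (hK : 1 ≤ K) (X : Finset α)
    (g : α → Fin K) : ∃ k, (#X : ℝ) ≤ K * #(X.filter fun i => g i = k) := by
  have : Nonempty (Fin K) := ⟨⟨0, hK⟩⟩
  obtain ⟨k, -, hk⟩ := exists_le_card_fiber_of_nsmul_le_card_of_maps_to (s := X)
    (t := (univ : Finset (Fin K))) (f := g) (b := (#X : ℝ) / K) (by simp) univ_nonempty (by
      have : (K : ℝ) ≠ 0 := by positivity
      simp [mul_div_cancel₀, this])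
  refine ⟨k, ?_⟩
  rwa [div_le_iff₀' (by positivity)] at hk

/-- If there are fewer clusters than communities, then some cluster contains a large part of two
different communities. -/
lemma exists_merged_communities {N K K₀ : ℕ} (hK : 1 ≤ K) (hKK₀ : K < K₀) (S : Finset (Fin N))
    (gs : Fin N → Fin K₀) (g : Fin N → Fin K) :
    ∃ a b k, a ≠ b ∧
      (#(S.filter fun i => gs i = a) : ℝ) ≤ K * #((S.filter fun i => gs i = a).filter (g · = k)) ∧
      (#(S.filter fun i => gs i = b) : ℝ) ≤ K * #((S.filter fun i => gs i = b).filter (g · = k)) := by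
  choose h hh using fun a => exists_card_le_mul_card_fiber hK (S.filter fun i => gs i = a) g
  obtain ⟨a, b, hab, e⟩ := Fintype.exists_ne_map_eq_of_card_lt h (by simpa using hKK₀)
  exact ⟨a, b, h a, hab, hh a, e ▸ hh b⟩

/-- A matrix that is constant on the blocks of `K < K₀` clusters is far from one which separates
`K₀` communities. -/
lemma le_sum_pairs_sq_sub {N K K₀ : ℕ} (hK : 1 ≤ K) (hKK₀ : K < K₀) (S : Finset (Fin N))
    (gs : Fin N → Fin K₀) (g : Fin N → Fin K) {β : Fin K₀ → Fin K₀ → ℝ}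
    (hβ : ∀ a b, β a b = β b a) {θ : Fin K → Fin K → ℝ} (hθ : ∀ k l, θ k l = θ l k)
    {δ r m : ℝ} (hδ₀ : 0 ≤ δ) (hm₀ : 0 ≤ m)
    (hδ : ∀ a b, a ≠ b → δ ≤ (β a a - β a b) ^ 2)
    (hr : ∀ a, K * r ≤ communitySize gs a)
    (hm : ∀ a, K * (m + 1) ≤ #(S.filter fun i => gs i = a)) :
    r * m * δ / 4 ≤ ∑ p ∈ pairs S, (θ (g p.1) (g p.2) - β (gs p.1) (gs p.2)) ^ 2 := by
  have hK' : (0 : ℝ) < K := by positivity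
  obtain ⟨a, b, k, hab, ha, hb⟩ := exists_merged_communities hK hKK₀ S gs g
  -- The row nodes are taken from the whole community, not only from the sample; this yields order
  -- `N n` pairs instead of `n ^ 2`.
  obtain ⟨l, hl⟩ := exists_card_le_mul_card_fiber hK (univ.filter fun i => gs i = a) g
  set X := (S.filter fun i => gs i = a).filter (g · = k)
  set Y := (S.filter fun i => gs i = b).filter (g · = k)
  set R := (univ.filter fun i => gs i = a).filter (g · = l)
  have hX : m + 1 ≤ #X := le_of_mul_le_mul_left ((hm a).trans ha) hK'
  have hY : m + 1 ≤ #Y := le_of_mul_le_mul_left ((hm b).trans hb) hK'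
  have hR : r ≤ #R := le_of_mul_le_mul_left ((hr a).trans hl) hK'
  have hXY : Disjoint X Y := by
    rw [disjoint_left]
    intro i hi hi'
    simp only [X, Y, mem_filter] at hi hi'
    exact hab (hi.1.2.symm.trans hi'.1.2)
  have hsub : X ∪ Y ⊆ S := by
    intro i hi
    simp only [X, Y, mem_union, mem_filter] at hi
    tauto
  have key := sum_erase_le_two_mul_sum_pairs (R := R) hsub
    (φ := fun i j => (θ (g i) (g j) - β (gs i) (gs j)) ^ 2)
    (fun i j => by rw [hθ, hβ]) (fun i j => sq_nonneg _)
  have hrow : ∀ i ∈ R, m * δ / 2 ≤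
      ∑ j ∈ (X ∪ Y).erase i, (θ (g i) (g j) - β (gs i) (gs j)) ^ 2 := by
    intro i hi
    simp only [R, mem_filter, mem_univ, true_and] at hi
    -- The `+ 1` in `hm` pays for the excluded diagonal entry `j = i`.
    have e1 : ∀ Z : Finset (Fin N), m + 1 ≤ #Z → m ≤ #(Z.erase i) := fun Z hZ => by
      have := pred_card_le_card_erase (s := Z) (a := i)
      have : (#Z : ℝ) ≤ #(Z.erase i) + 1 := by exact_mod_cast (by omega)
      linarith
    have eX : ∑ j ∈ X.erase i, (θ (g i) (g j) - β (gs i) (gs j)) ^ 2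
        = #(X.erase i) * (θ l k - β a a) ^ 2 := by
      rw [← nsmul_eq_mul, ← sum_const]
      refine sum_congr rfl fun j hj => ?_
      simp only [X, mem_erase, mem_filter] at hj
      rw [hi.1, hi.2, hj.2.2, hj.2.1.2]
    have eY : ∑ j ∈ Y.erase i, (θ (g i) (g j) - β (gs i) (gs j)) ^ 2
        = #(Y.erase i) * (θ l k - β a b) ^ 2 := by
      rw [← nsmul_eq_mul, ← sum_const]
      refine sum_congr rfl fun j hj => ?_
      simp only [Y, mem_erase, mem_filter] at hj
      rw [hi.1, hi.2, hj.2.2, hj.2.1.2]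
    rw [erase_union_distrib, sum_union (disjoint_of_subset_left (erase_subset _ _)
      (disjoint_of_subset_right (erase_subset _ _) hXY)), eX, eY]
    have h1 := mul_le_mul_of_nonneg_right (e1 X hX) (sq_nonneg (θ l k - β a a))
    have h2 := mul_le_mul_of_nonneg_right (e1 Y hY) (sq_nonneg (θ l k - β a b))
    -- The single value `θ l k` cannot be close to both `β a a` and `β a b`: `u ^ 2 + v ^ 2 ≥ (u -
    -- v) ^ 2 / 2`.
    have h3 : δ / 2 ≤ (θ l k - β a a) ^ 2 + (θ l k - β a b) ^ 2 := by
      nlinarith [hδ a b hab, sq_nonneg ((θ l k - β a a) + (θ l k - β a b))]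
    nlinarith [mul_le_mul_of_nonneg_left h3 hm₀]
  have hsum := sum_le_sum hrow
  rw [sum_const, nsmul_eq_mul] at hsum
  have : r * (m * δ / 2) ≤ #R * (m * δ / 2) := by gcongr
  linarith

end

section

/-! ### The likelihood as a product over node pairs -/

/-- The log-likelihood of the outcome `a ∈ {0, 1}` of a Bernoulli variable. -/
def bernoulliLogLik (q a : ℝ) : ℝ := a * Real.log q + (1 - a) * Real.log (1 - q)

/-- The square root of the likelihood ratio of two Bernoulli laws at the outcome `a ∈ {0, 1}`. -/
def sqrtRatio (q q' a : ℝ) : ℝ := if a = 1 then √(q / q') else √((1 - q) / (1 - q'))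

/-- The connection probabilities with rational entries `min 1 (t / m)`. -/
def gridMatrix {K m : ℕ} (c : Sym2 (Fin K) → Fin m × Fin m) (k l : Fin K) : ℝ :=
  min 1 (((c s(k, l)).1 : ℝ) / ((c s(k, l)).2 : ℝ))

lemma gridMatrix_comm {K m : ℕ} (c : Sym2 (Fin K) → Fin m × Fin m) (k l : Fin K) :
    gridMatrix c k l = gridMatrix c l k := by
  rw [gridMatrix, gridMatrix, Sym2.eq_swap]

lemma gridMatrix_nonneg {K m : ℕ} (c : Sym2 (Fin K) → Fin m × Fin m) (k l : Fin K) :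
    0 ≤ gridMatrix c k l := le_min zero_le_one (by positivity)

lemma gridMatrix_le_one {K m : ℕ} (c : Sym2 (Fin K) → Fin m × Fin m) (k l : Fin K) :
    gridMatrix c k l ≤ 1 := min_le_left _ _

lemma blockPairs_comm {N K : ℕ} (S : Finset (Fin N)) (g : Fin N → Fin K) (k l : Fin K) :
    blockPairs S g k l = blockPairs S g l k := by
  simp only [blockPairs, or_comm]

/-- Each pair lies in exactly one block with `k ≤ l`, the one given by the minimum and maximum of
its two labels. -/
lemma sum_blockPairs {N K : ℕ} (S : Finset (Fin N)) (g : Fin N → Fin K)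
    (f : Fin N × Fin N → ℝ) :
    ∑ k, ∑ l ∈ univ.filter (fun l => k ≤ l), ∑ p ∈ blockPairs S g k l, f p
      = ∑ p ∈ pairs S, f p := by
  simp only [blockPairs, sum_filter]
  have h1 : ∀ k l : Fin K, (if k ≤ l then ∑ p ∈ pairs S,
      (if (g p.1 = k ∧ g p.2 = l) ∨ (g p.1 = l ∧ g p.2 = k) then f p else 0) else 0)
      = ∑ p ∈ pairs S, if k = min (g p.1) (g p.2) then
        (if l = max (g p.1) (g p.2) then f p else 0) else 0 := by
    intro k l
    split_ifs with h
    · refine sum_congr rfl fun p _ => ?_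
      rw [← ite_and]
      congr 1
      rw [eq_iff_iff]
      rcases le_total (g p.1) (g p.2) with h' | h'
      · simp only [min_eq_left h', max_eq_right h']
        constructor
        · rintro (⟨rfl, rfl⟩ | ⟨rfl, rfl⟩)
          · simp
          · exact ⟨le_antisymm h h', le_antisymm h' h⟩
        · rintro ⟨rfl, rfl⟩; simp
      · simp only [min_eq_right h', max_eq_left h']
        constructor
        · rintro (⟨rfl, rfl⟩ | ⟨rfl, rfl⟩)
          · exact ⟨le_antisymm h h', le_antisymm h' h⟩
          · simp
        · rintro ⟨rfl, rfl⟩; simp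
    · refine (sum_eq_zero fun p _ => ?_).symm
      rw [← ite_and, if_neg]
      rintro ⟨rfl, rfl⟩
      exact h min_le_max
  simp_rw [h1]
  rw [sum_congr rfl fun k _ => sum_comm, sum_comm]
  simp

lemma obsCount_mul_add {N K : ℕ} (A : Matrix (Fin N) (Fin N) ℝ) (S : Finset (Fin N))
    (g : Fin N → Fin K) {B : Matrix (Fin K) (Fin K) ℝ} (hB : B.IsSymm) (k l : Fin K) :
    obsCount A S g k l * Real.log (B k l) +
      (maxCount S g k l - obsCount A S g k l) * Real.log (1 - B k l)
      = ∑ p ∈ blockPairs S g k l, bernoulliLogLik (B (g p.1) (g p.2)) (A p.1 p.2) := by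
  have h : ∀ p ∈ blockPairs S g k l, bernoulliLogLik (B (g p.1) (g p.2)) (A p.1 p.2)
      = A p.1 p.2 * Real.log (B k l) + (1 - A p.1 p.2) * Real.log (1 - B k l) := by
    intro p hp
    simp only [blockPairs, mem_filter] at hp
    rcases hp.2 with ⟨h1, h2⟩ | ⟨h1, h2⟩
    · rw [h1, h2, bernoulliLogLik]
    · rw [h1, h2, bernoulliLogLik, hB.apply]
  rw [sum_congr rfl h, sum_add_distrib, ← sum_mul, ← sum_mul, sum_sub_distrib, obsCount, maxCount]
  simp

lemma logLik_eq_sum_pairs {N K : ℕ} (A : Matrix (Fin N) (Fin N) ℝ) (S : Finset (Fin N))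
    (g : Fin N → Fin K) {B : Matrix (Fin K) (Fin K) ℝ} (hB : B.IsSymm) :
    logLik A S g B = ∑ p ∈ pairs S, bernoulliLogLik (B (g p.1) (g p.2)) (A p.1 p.2) := by
  rw [← sum_blockPairs S g]
  exact sum_congr rfl fun k _ => sum_congr rfl fun l _ => obsCount_mul_add A S g hB k l

/-- The binomial likelihood is maximal at the observed frequency. -/
lemma mul_log_add_mul_log_le {o m q : ℝ} (ho : 0 ≤ o) (hom : o ≤ m) (hq₀ : 0 < q) (hq₁ : q < 1) :
    o * Real.log q + (m - o) * Real.log (1 - q)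
      ≤ o * Real.log (o / m) + (m - o) * Real.log (1 - o / m) := by
  -- This is `log t ≤ t - 1` at `t = y * m / x`. The error terms `y * m - x` of the two outcomes
  -- cancel.
  have key : ∀ x y : ℝ, 0 ≤ x → 0 < y → 0 < m →
      x * Real.log y ≤ x * Real.log (x / m) + (y * m - x) := by
    intro x y hx hy hm
    rcases hx.eq_or_lt with rfl | hx
    · simp; positivity
    · have h1 := Real.log_le_sub_one_of_pos (show 0 < y * m / x by positivity)
      have h2 : Real.log (y * m / x) = Real.log y - Real.log (x / m) := by
        rw [← Real.log_div hy.ne' (by positivity)]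
        congr 1
        field_simp
      have h3 : x * (y * m / x - 1) = y * m - x := by field_simp
      have := mul_le_mul_of_nonneg_left h1 hx.le
      rw [h3, h2] at this
      linarith
  rcases (ho.trans hom).eq_or_lt with rfl | hm
  · have : o = 0 := le_antisymm hom ho
    simp [this]
  · have h1 := key o q ho hq₀ hm
    have h2 := key (m - o) (1 - q) (by linarith) (by linarith) hm
    have h3 : (m - o) / m = 1 - o / m := by field_simp
    rw [h3] at h2
    linarith

variable {N K K₀ : ℕ} {A : Matrix (Fin N) (Fin N) ℝ}

lemma obsCount_eq_card (hA : ∀ i j, A i j = 0 ∨ A i j = 1) (S : Finset (Fin N))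
    (g : Fin N → Fin K) (k l : Fin K) :
    obsCount A S g k l = #((blockPairs S g k l).filter fun p => A p.1 p.2 = 1) := by
  rw [obsCount, card_filter, Nat.cast_sum]
  refine sum_congr rfl fun p _ => ?_
  rcases hA p.1 p.2 with h | h <;> simp [h]

lemma obsCount_nonneg (hA : ∀ i j, A i j = 0 ∨ A i j = 1) (S : Finset (Fin N))
    (g : Fin N → Fin K) (k l : Fin K) : 0 ≤ obsCount A S g k l := by
  rw [obsCount_eq_card hA]; positivity

lemma obsCount_le_maxCount (hA : ∀ i j, A i j = 0 ∨ A i j = 1) (S : Finset (Fin N))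
    (g : Fin N → Fin K) (k l : Fin K) : obsCount A S g k l ≤ maxCount S g k l := by
  rw [obsCount_eq_card hA, maxCount]
  exact_mod_cast card_filter_le _ _

/-- The maximum likelihood estimator of the connectivity matrix for the label vector `g`. -/
def freqMatrix (A : Matrix (Fin N) (Fin N) ℝ) (S : Finset (Fin N)) (g : Fin N → Fin K) :
    Matrix (Fin K) (Fin K) ℝ :=
  fun k l => obsCount A S g k l / maxCount S g k l

lemma freqMatrix_isSymm (A : Matrix (Fin N) (Fin N) ℝ) (S : Finset (Fin N))
    (g : Fin N → Fin K) : (freqMatrix A S g).IsSymm := by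
  ext k l
  simp only [Matrix.transpose_apply, freqMatrix, obsCount, maxCount, blockPairs_comm S g l k]

lemma logLik_le_freqMatrix (hA : ∀ i j, A i j = 0 ∨ A i j = 1) (S : Finset (Fin N))
    (g : Fin N → Fin K) {B : Matrix (Fin K) (Fin K) ℝ} (hB : B ∈ connMatrices K) :
    logLik A S g B ≤ logLik A S g (freqMatrix A S g) :=
  sum_le_sum fun k _ => sum_le_sum fun l _ => mul_log_add_mul_log_le (obsCount_nonneg hA S g k l)
    (obsCount_le_maxCount hA S g k l) (hB.2 k l).1 (hB.2 k l).2

/-- This discretizes the supremum over `B` without error. Empty blocks cause no trouble, as both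
sides are then `0 / 0 = 0`. -/
lemma exists_gridMatrix_eq_freqMatrix (hA : ∀ i j, A i j = 0 ∨ A i j = 1) (S : Finset (Fin N))
    (g : Fin N → Fin K) :
    ∃ c : Sym2 (Fin K) → Fin (N ^ 2 + 1) × Fin (N ^ 2 + 1),
      ∀ k l, gridMatrix c k l = freqMatrix A S g k l := by
  have hcard : ∀ s : Finset (Fin N × Fin N), #s < N ^ 2 + 1 := fun s => by
    have := card_le_univ s
    simp only [Fintype.card_prod, Fintype.card_fin] at this
    nlinarith
  refine ⟨Sym2.lift ⟨fun k l => (⟨#((blockPairs S g k l).filter fun p => A p.1 p.2 = 1), hcard _⟩,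
    ⟨#(blockPairs S g k l), hcard _⟩), fun k l => by simp only [blockPairs_comm S g k l]⟩, ?_⟩
  intro k l
  simp only [gridMatrix, Sym2.lift_mk]
  rw [← obsCount_eq_card hA]
  exact min_eq_right (div_le_one_of_le₀ (obsCount_le_maxCount hA S g k l) (Nat.cast_nonneg _))

/-- Frequencies may equal 0 or 1, where the convention `log 0 = 0` is not the true likelihood. An
observed edge excludes 0 and an observed non-edge excludes 1, so `log 0` never enters with a nonzero
coefficient. -/
lemma freqMatrix_pos (hA : ∀ i j, A i j = 0 ∨ A i j = 1) {S : Finset (Fin N)}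
    (g : Fin N → Fin K) {p : Fin N × Fin N} (hp : p ∈ pairs S) (h1 : A p.1 p.2 = 1) :
    0 < freqMatrix A S g (g p.1) (g p.2) := by
  have hmem : p ∈ blockPairs S g (g p.1) (g p.2) := by simp [blockPairs, hp]
  have : 0 < obsCount A S g (g p.1) (g p.2) := by
    rw [obsCount_eq_card hA]
    exact_mod_cast card_pos.2 ⟨p, by simp [hmem, h1]⟩
  exact div_pos this (this.trans_le (obsCount_le_maxCount hA _ _ _ _))

lemma freqMatrix_lt_one (hA : ∀ i j, A i j = 0 ∨ A i j = 1) {S : Finset (Fin N)}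
    (g : Fin N → Fin K) {p : Fin N × Fin N} (hp : p ∈ pairs S) (h0 : A p.1 p.2 = 0) :
    freqMatrix A S g (g p.1) (g p.2) < 1 := by
  have hmem : p ∈ blockPairs S g (g p.1) (g p.2) := by simp [blockPairs, hp]
  have : obsCount A S g (g p.1) (g p.2) < maxCount S g (g p.1) (g p.2) := by
    rw [obsCount_eq_card hA, maxCount]
    exact_mod_cast card_lt_card (filter_ssubset.2 ⟨p, hmem, by simp [h0]⟩)
  exact (div_lt_one ((obsCount_nonneg hA _ _ _ _).trans_lt this)).2 this

lemma exp_half_bernoulliLogLik_sub {q q' a : ℝ} (ha : a = 0 ∨ a = 1) (h1 : a = 1 → 0 < q)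
    (h0 : a = 0 → q < 1) (hq₀ : 0 < q') (hq₁ : q' < 1) :
    Real.exp ((bernoulliLogLik q a - bernoulliLogLik q' a) / 2) = sqrtRatio q q' a := by
  have key : ∀ x y : ℝ, 0 < x → 0 < y → Real.exp ((Real.log x - Real.log y) / 2) = √(x / y) := by
    intro x y hx hy
    rw [Real.sqrt_eq_rpow, Real.rpow_def_of_pos (by positivity),
      Real.log_div hx.ne' hy.ne']
    ring_nf
  rcases ha with rfl | rfl
  · simpa [bernoulliLogLik, sqrtRatio] using
      key (1 - q) (1 - q') (by linarith [h0 rfl]) (by linarith)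
  · simpa [bernoulliLogLik, sqrtRatio] using key q q' (h1 rfl) hq₀

lemma connMatrices_nonempty (K : ℕ) : (connMatrices K).Nonempty :=
  ⟨fun _ _ => 1 / 2, by ext; rfl, fun _ _ => by norm_num⟩

/-- The link counts depend only on the labels inside `S`, so these can be fixed before the other
labels are optimized. -/
lemma candidates_nonempty (A : Matrix (Fin N) (Fin N) ℝ) (S : Finset (Fin N)) (hK : 1 ≤ K) :
    (candidates A S K).Nonempty := by
  have : Nonempty (Fin K) := ⟨⟨0, hK⟩⟩
  let k₀ : Fin K := ⟨0, hK⟩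
  choose h hh using fun i => Finite.exists_max (linksTo A S (fun _ => k₀) i)
  refine ⟨fun i => if i ∈ S then k₀ else h i, fun i hi k => ?_⟩
  have hl : ∀ k, linksTo A S (fun i => if i ∈ S then k₀ else h i) i k
      = linksTo A S (fun _ => k₀) i k := by
    intro k
    rw [linksTo, linksTo]
    congr 1
    refine filter_congr fun j hj => by simp [hj]
  rw [hl, hl]
  simpa [hi] using hh i k

/-- A large log-likelihood ratio is witnessed by a label vector and a connectivity matrix out of a
finite family which does not depend on the network. -/
lemma exists_exp_le_prod_sqrtRatio (hA : ∀ i j, A i j = 0 ∨ A i j = 1) (S : Finset (Fin N))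
    (hK : 1 ≤ K) {gs : Fin N → Fin K₀} {Bs : Matrix (Fin K₀) (Fin K₀) ℝ}
    (hBs : Bs ∈ connMatrices K₀) {x : ℝ} (hx : -x < logLikRatio A S K gs Bs) :
    ∃ (g : Fin N → Fin K) (c : Sym2 (Fin K) → Fin (N ^ 2 + 1) × Fin (N ^ 2 + 1)),
      Real.exp (-x / 2) ≤ ∏ p ∈ pairs S,
        sqrtRatio (gridMatrix c (g p.1) (g p.2)) (Bs (gs p.1) (gs p.2)) (A p.1 p.2) := by
  have := (candidates_nonempty A S hK).to_subtype
  have := (connMatrices_nonempty K).to_subtype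
  rw [logLikRatio, lt_sub_iff_add_lt] at hx
  -- Nonempty index sets suffice here; boundedness of the suprema plays no role.
  obtain ⟨g, hg⟩ := exists_lt_of_lt_ciSup hx
  obtain ⟨B, hB⟩ := exists_lt_of_lt_ciSup hg
  obtain ⟨c, hc⟩ := exists_gridMatrix_eq_freqMatrix hA S g.1
  refine ⟨g.1, c, ?_⟩
  have h1 := hB.trans_le (logLik_le_freqMatrix hA S g.1 B.2)
  have h2 : ∏ p ∈ pairs S,
      sqrtRatio (gridMatrix c (g.1 p.1) (g.1 p.2)) (Bs (gs p.1) (gs p.2)) (A p.1 p.2)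
      = Real.exp ((logLik A S g.1 (freqMatrix A S g.1) - logLik A S gs Bs) / 2) := by
    rw [logLik_eq_sum_pairs A S g.1 (freqMatrix_isSymm A S g.1),
      logLik_eq_sum_pairs A S gs hBs.1, ← sum_sub_distrib, sum_div, Real.exp_sum]
    refine prod_congr rfl fun p hp => ?_
    rw [hc, exp_half_bernoulliLogLik_sub (hA _ _) (freqMatrix_pos hA g.1 hp)
      (freqMatrix_lt_one hA g.1 hp) (hBs.2 _ _).1 (hBs.2 _ _).2]
  rw [h2, Real.exp_le_exp]
  linarith

end

section

/-! ### Exponential tail bound for a fixed parameter -/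

lemma sqrtRatio_nonneg (q q' a : ℝ) : 0 ≤ sqrtRatio q q' a := by
  unfold sqrtRatio; split_ifs <;> positivity

@[fun_prop]
lemma measurable_sqrtRatio (q q' : ℝ) : Measurable (sqrtRatio q q') :=
  Measurable.ite (measurableSet_singleton 1) measurable_const measurable_const

/-- The affinity of two Bernoulli laws is bounded through their Hellinger distance. -/
lemma bernoulli_affinity_le {q q' : ℝ} (hq₀ : 0 ≤ q) (hq₁ : q ≤ 1) (hq'₀ : 0 < q')
    (hq'₁ : q' < 1) :
    √(q / q') * q' + √((1 - q) / (1 - q')) * (1 - q') ≤ Real.exp (-((√q - √q') ^ 2 / 2)) := by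
  have key : ∀ x y : ℝ, 0 ≤ x → 0 < y → √(x / y) * y = √x * √y := by
    intro x y hx hy
    rw [Real.sqrt_div hx]
    have := Real.mul_self_sqrt hy.le
    rw [div_mul_eq_mul_div, div_eq_iff (Real.sqrt_pos.2 hy).ne', mul_assoc, this]
  rw [key q q' hq₀ hq'₀, key (1 - q) (1 - q') (by linarith) (by linarith)]
  -- The affinity is 1 minus half the sum of two squares; the one for the outcome 0 is dropped.
  have h1 := Real.add_one_le_exp (-((√q - √q') ^ 2 / 2))
  nlinarith [Real.mul_self_sqrt hq₀, Real.mul_self_sqrt hq'₀.le,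
    Real.mul_self_sqrt (show 0 ≤ 1 - q by linarith),
    Real.mul_self_sqrt (show 0 ≤ 1 - q' by linarith), sq_nonneg (√(1 - q) - √(1 - q'))]

variable {Ω : Type*} [MeasurableSpace Ω] {μ : Measure Ω} {N K₀ : ℕ}
  {A : Ω → Matrix (Fin N) (Fin N) ℝ} {gs : Fin N → Fin K₀} {B : Matrix (Fin K₀) (Fin K₀) ℝ}

lemma ne_of_mem_pairs {S : Finset (Fin N)} {p : Fin N × Fin N} (hp : p ∈ pairs S) :
    p.1 ≠ p.2 := by
  rcases mem_pairs.1 hp with h | h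
  · exact h.2.2.ne
  · rintro e
    exact h.1 (e ▸ h.2)

/-- Sorting each pair is injective on `pairs S`, because no unordered pair occurs there in both
orders; independence above the diagonal thus carries over. -/
lemma IsSBM.iIndepFun_pairs (hA : IsSBM μ A gs B) (S : Finset (Fin N)) :
    iIndepFun (fun (p : pairs S) (ω : Ω) => A ω p.1.1 p.1.2) μ := by
  classical
  let σ : pairs S → {p : Fin N × Fin N // p.1 < p.2} := fun p =>
    if h : p.1.1 < p.1.2 then ⟨p.1, h⟩
    else ⟨p.1.swap, lt_of_le_of_ne (not_lt.1 h) (ne_of_mem_pairs p.2).symm⟩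
  have hσ : Function.Injective σ := by
    rintro ⟨⟨i, j⟩, hp⟩ ⟨⟨i', j'⟩, hp'⟩ h
    have hh := mem_pairs.1 hp
    have hh' := mem_pairs.1 hp'
    simp only at hh hh'
    have := congrArg Subtype.val h
    simp only [σ] at this
    split_ifs at this with h1 h2 h2
    · exact Subtype.ext this
    · simp only [Prod.swap_prod_mk, Prod.mk.injEq] at this
      obtain ⟨rfl, rfl⟩ := this
      exfalso; tauto
    · simp only [Prod.swap_prod_mk, Prod.mk.injEq] at this
      obtain ⟨rfl, rfl⟩ := this
      exfalso; tauto
    · exact Subtype.ext (Prod.swap_injective this)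
  have := hA.indep.precomp hσ
  convert this using 2 with p
  ext ω
  simp only [σ]
  split_ifs with h
  · rfl
  · exact (hA.symm ω).apply _ _

lemma IsSBM.measure_eq_one (hA : IsSBM μ A gs B) {i j : Fin N} (hij : i ≠ j) :
    μ {ω | A ω i j = 1} = ENNReal.ofReal (B (gs i) (gs j)) := by
  rcases lt_or_gt_of_ne hij with h | h
  · exact hA.prob i j h
  · rw [← hA.conn.1.apply, ← hA.prob j i h]
    simp_rw [(hA.symm _).apply j i]

variable [IsProbabilityMeasure μ]

lemma IsSBM.lintegral_sqrtRatio_le (hA : IsSBM μ A gs B) {i j : Fin N} (hij : i ≠ j) {q : ℝ}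
    (hq₀ : 0 ≤ q) (hq₁ : q ≤ 1) :
    ∫⁻ ω, ENNReal.ofReal (sqrtRatio q (B (gs i) (gs j)) (A ω i j)) ∂μ
      ≤ ENNReal.ofReal (Real.exp (-((√q - √(B (gs i) (gs j))) ^ 2 / 2))) := by
  obtain ⟨hb₀, hb₁⟩ := hA.conn.2 (gs i) (gs j)
  set b := B (gs i) (gs j) with hb
  have hm : MeasurableSet {ω | A ω i j = 1} := hA.measurable i j (measurableSet_singleton 1)
  have hf : ∀ ω, ENNReal.ofReal (sqrtRatio q b (A ω i j))
      = {ω | A ω i j = 1}.indicator (fun _ => ENNReal.ofReal √(q / b)) ω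
        + {ω | A ω i j = 1}ᶜ.indicator (fun _ => ENNReal.ofReal √((1 - q) / (1 - b))) ω := by
    intro ω
    by_cases h : A ω i j = 1 <;> simp [sqrtRatio, h]
  have hcompl : μ {ω | A ω i j = 1}ᶜ = ENNReal.ofReal (1 - b) := by
    rw [prob_compl_eq_one_sub hm, hA.measure_eq_one hij, ENNReal.ofReal_sub _ hb₀.le,
      ENNReal.ofReal_one]
  simp_rw [hf]
  rw [lintegral_add_left (measurable_const.indicator hm), lintegral_indicator_const hm,
    lintegral_indicator_const hm.compl, hcompl, hA.measure_eq_one hij,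
    ← ENNReal.ofReal_mul (by positivity), ← ENNReal.ofReal_mul (by positivity),
    ← ENNReal.ofReal_add (by positivity) (mul_nonneg (by positivity) (by linarith))]
  exact ENNReal.ofReal_le_ofReal (bernoulli_affinity_le hq₀ hq₁ hb₀ hb₁)

/-- Chernoff's method with exponent 1/2: by independence the expectation of the product factorizes
into affinities. -/
lemma IsSBM.measure_le_prod_sqrtRatio_le (hA : IsSBM μ A gs B) (S : Finset (Fin N))
    {q : Fin N → Fin N → ℝ} (hq₀ : ∀ i j, 0 ≤ q i j) (hq₁ : ∀ i j, q i j ≤ 1) (x : ℝ) :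
    μ {ω | Real.exp (-x / 2) ≤
        ∏ p ∈ pairs S, sqrtRatio (q p.1 p.2) (B (gs p.1) (gs p.2)) (A ω p.1 p.2)}
      ≤ ENNReal.ofReal (Real.exp
          (x / 2 - (∑ p ∈ pairs S, (√(q p.1 p.2) - √(B (gs p.1) (gs p.2))) ^ 2) / 2)) := by
  set X : pairs S → Ω → ENNReal := fun p ω => ENNReal.ofReal
    (sqrtRatio (q p.1.1 p.1.2) (B (gs p.1.1) (gs p.1.2)) (A ω p.1.1 p.1.2)) with hX
  have hXm : ∀ p, Measurable (X p) := fun p =>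
    ((measurable_sqrtRatio _ _).comp (hA.measurable _ _)).ennreal_ofReal
  have hind : iIndepFun X μ := (hA.iIndepFun_pairs S).comp
    (fun p a => ENNReal.ofReal (sqrtRatio (q p.1.1 p.1.2) (B (gs p.1.1) (gs p.1.2)) a))
    fun p => (measurable_sqrtRatio _ _).ennreal_ofReal
  have hprod : ∀ ω, ENNReal.ofReal (∏ p ∈ pairs S,
      sqrtRatio (q p.1 p.2) (B (gs p.1) (gs p.2)) (A ω p.1 p.2)) = ∏ p, X p ω := by
    intro ω
    rw [ENNReal.ofReal_prod_of_nonneg fun p _ => sqrtRatio_nonneg _ _ _,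
      ← prod_coe_sort (pairs S)]
  have hint : ∫⁻ ω, ∏ p, X p ω ∂μ ≤ ENNReal.ofReal (Real.exp
      (-((∑ p ∈ pairs S, (√(q p.1 p.2) - √(B (gs p.1) (gs p.2))) ^ 2) / 2))) := by
    rw [lintegral_prod_eq_prod_lintegral_of_indepFun _ _ hind hXm, sum_div, ← sum_neg_distrib,
      Real.exp_sum, ENNReal.ofReal_prod_of_nonneg fun p _ => (Real.exp_pos _).le,
      ← prod_coe_sort (pairs S)]
    exact prod_le_prod' fun p _ => hA.lintegral_sqrtRatio_le (ne_of_mem_pairs p.2)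
      (hq₀ _ _) (hq₁ _ _)
  have hε : ENNReal.ofReal (Real.exp (-x / 2)) ≠ 0 := by
    simp [Real.exp_pos]
  calc _ ≤ μ {ω | ENNReal.ofReal (Real.exp (-x / 2)) ≤ ∏ p, X p ω} := by
        refine measure_mono fun ω hω => ?_
        simp only [Set.mem_ofPred_eq, ← hprod]
        exact ENNReal.ofReal_le_ofReal hω
    _ ≤ (∫⁻ ω, ∏ p, X p ω ∂μ) / ENNReal.ofReal (Real.exp (-x / 2)) :=
        meas_ge_le_lintegral_div (Finset.aemeasurable_fun_prod _ fun p _ => (hXm p).aemeasurable)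
          hε ENNReal.ofReal_ne_top
    _ ≤ ENNReal.ofReal (Real.exp
      (-((∑ p ∈ pairs S, (√(q p.1 p.2) - √(B (gs p.1) (gs p.2))) ^ 2) / 2)))
        / ENNReal.ofReal (Real.exp (-x / 2)) := by gcongr
    _ = _ := by
        rw [← ENNReal.ofReal_div_of_pos (Real.exp_pos _), ← Real.exp_sub]
        congr 2
        ring

/-- Tail bound for the log-likelihood ratio, uniformly over all well-balanced node samples. -/
lemma IsSBM.measure_exists_lt_logLikRatio_le (hA : IsSBM μ A gs B) {K : ℕ} (hK : 1 ≤ K)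
    (𝒮 : Set (Finset (Fin N))) {x d : ℝ}
    (hd : ∀ T ∈ 𝒮, ∀ (g : Fin N → Fin K) (θ : Fin K → Fin K → ℝ), (∀ k l, θ k l = θ l k) →
      d ≤ ∑ p ∈ pairs T, (θ (g p.1) (g p.2) - √(B (gs p.1) (gs p.2))) ^ 2) :
    μ {ω | ∃ T ∈ 𝒮, -x < logLikRatio (A ω) T K gs B} ≤
      ENNReal.ofReal ((2 ^ N * (K ^ N * ((N ^ 2 + 1) * (N ^ 2 + 1)) ^ Fintype.card (Sym2 (Fin K))))
        * Real.exp (x / 2 - d / 2)) := by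
  classical
  -- Including the sample in the index costs a factor `2 ^ N` and allows a random sample to be
  -- inserted afterwards.
  let I := Finset (Fin N) × (Fin N → Fin K) × (Sym2 (Fin K) → Fin (N ^ 2 + 1) × Fin (N ^ 2 + 1))
  let E : I → Set Ω := fun t => {ω | t.1 ∈ 𝒮 ∧ Real.exp (-x / 2) ≤ ∏ p ∈ pairs t.1,
    sqrtRatio (gridMatrix t.2.2 (t.2.1 p.1) (t.2.1 p.2)) (B (gs p.1) (gs p.2)) (A ω p.1 p.2)}
  have hsub : {ω | ∃ T ∈ 𝒮, -x < logLikRatio (A ω) T K gs B} ⊆ ⋃ t, E t := by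
    rintro ω ⟨T, hT, hω⟩
    obtain ⟨g, c, h⟩ := exists_exp_le_prod_sqrtRatio (hA.zero_or_one ω) T hK hA.conn hω
    exact Set.mem_iUnion.2 ⟨(T, g, c), hT, h⟩
  have hE : ∀ t, μ (E t) ≤ ENNReal.ofReal (Real.exp (x / 2 - d / 2)) := by
    rintro ⟨T, g, c⟩
    by_cases hT : T ∈ 𝒮
    · refine (measure_mono fun ω hω => hω.2).trans ((hA.measure_le_prod_sqrtRatio_le T
        (q := fun i j => gridMatrix c (g i) (g j)) (fun _ _ => gridMatrix_nonneg _ _ _)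
        (fun _ _ => gridMatrix_le_one _ _ _) x).trans (ENNReal.ofReal_le_ofReal ?_))
      have := hd T hT g (fun k l => √(gridMatrix c k l)) fun k l => by rw [gridMatrix_comm]
      exact Real.exp_le_exp.2 (by linarith)
    · simp [E, hT]
  calc _ ≤ μ (⋃ t, E t) := measure_mono hsub
    _ ≤ ∑ t, μ (E t) := measure_iUnion_fintype_le μ E
    _ ≤ ∑ t : I, ENNReal.ofReal (Real.exp (x / 2 - d / 2)) := sum_le_sum fun t _ => hE t
    _ = _ := by
      rw [sum_const, nsmul_eq_mul, ENNReal.ofReal_mul (by positivity), ← ENNReal.ofReal_natCast]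
      congr 2
      simp [I, Fintype.card_prod, Fintype.card_finset]

end

section

/-! ### Simple random sampling -/

lemma card_powersetCard_filter_mem {N n : ℕ} (hn : 1 ≤ n) (i : Fin N) :
    (#((powersetCard n (univ : Finset (Fin N))).filter (i ∈ ·)) : ℝ)
      = n / N * N.choose n := by
  have h := card_filter_powersetCard_subset {i} (univ : Finset (Fin N)) n (subset_univ _)
    (by simpa using hn)
  simp only [singleton_subset_iff, card_univ, Fintype.card_fin, card_singleton] at h
  rw [h]
  have hN : 0 < N := i.pos
  obtain ⟨N, rfl⟩ := Nat.exists_eq_add_of_le' hN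
  obtain ⟨n, rfl⟩ := Nat.exists_eq_add_of_le' hn
  have := Nat.add_one_mul_choose_eq N n
  rw [Nat.add_sub_cancel, Nat.add_sub_cancel, div_mul_eq_mul_div, eq_div_iff (by positivity)]
  have e : (((N + 1) * N.choose n : ℕ) : ℝ) = (((N + 1).choose (n + 1) * (n + 1) : ℕ) : ℝ) := by
    rw [this]
  push_cast at e ⊢
  linarith

/-- Negative correlation of sampling without replacement: `(n - 1) / (N - 1) ≤ n / N`. -/
lemma card_powersetCard_filter_mem_mem_le {N n : ℕ} (hnN : n ≤ N) {i j : Fin N} (hij : i ≠ j) :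
    (#((powersetCard n (univ : Finset (Fin N))).filter fun T => i ∈ T ∧ j ∈ T) : ℝ)
      ≤ (n / N) ^ 2 * N.choose n := by
  rcases lt_or_ge n 2 with hn | hn
  · rw [filter_eq_empty_iff.2]
    · simp only [card_empty, Nat.cast_zero]
      positivity
    · rintro T hT ⟨hi, hj⟩
      have h1 : #T ≤ 1 := by
        have := (mem_powersetCard.1 hT).2
        omega
      exact hij (card_le_one.1 h1 i hi j hj)
  · have h := card_filter_powersetCard_subset {i, j} (univ : Finset (Fin N)) n (subset_univ _)
      (by rwa [card_pair hij])
    simp only [insert_subset_iff, singleton_subset_iff, card_univ, Fintype.card_fin,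
      card_pair hij] at h
    rw [h]
    obtain ⟨N, rfl⟩ := Nat.exists_eq_add_of_le' (hn.trans hnN)
    obtain ⟨n, rfl⟩ := Nat.exists_eq_add_of_le' hn
    rw [Nat.add_sub_cancel, Nat.add_sub_cancel]
    have e1 : (((N + 1) * N.choose n : ℕ) : ℝ) = (((N + 1).choose (n + 1) * (n + 1) : ℕ) : ℝ) := by
      rw [Nat.add_one_mul_choose_eq N n]
    have e2 : (((N + 2) * (N + 1).choose (n + 1) : ℕ) : ℝ)
        = (((N + 2).choose (n + 2) * (n + 2) : ℕ) : ℝ) := by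
      rw [Nat.add_one_mul_choose_eq (N + 1) (n + 1)]
    have hle : (n : ℝ) ≤ N := by exact_mod_cast (by omega : n ≤ N)
    push_cast at e1 e2 ⊢
    have e3 : (N.choose n : ℝ) = (n + 1) / (N + 1) * ((n + 2) / (N + 2))
        * (N + 2).choose (n + 2) := by
      field_simp
      linear_combination (N + 2 : ℝ) * e1 + (n + 1 : ℝ) * e2
    rw [e3, sq]
    have : ((n : ℝ) + 1) / (N + 1) ≤ (n + 2) / (N + 2) := by
      rw [div_le_div_iff₀ (by positivity) (by positivity)]
      nlinarith
    gcongr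

/-- Up to the factor `N.choose n`, the variance of the hypergeometric count is at most its mean,
since the covariances are not positive. -/
lemma sum_powersetCard_sq_le {N n : ℕ} (hn : 1 ≤ n) (hnN : n ≤ N) (C : Finset (Fin N)) :
    ∑ T ∈ powersetCard n (univ : Finset (Fin N)), ((#(T ∩ C) : ℝ) - n * #C / N) ^ 2
      ≤ n * #C / N * N.choose n := by
  have hX : ∀ T : Finset (Fin N), (#(T ∩ C) : ℝ) = ∑ i ∈ C, if i ∈ T then 1 else 0 := by
    intro T
    rw [inter_comm, ← filter_mem_eq_inter, card_filter]
    push_cast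
    rfl
  have h1 : ∑ T ∈ powersetCard n (univ : Finset (Fin N)), (#(T ∩ C) : ℝ)
      = #C * (n / N * N.choose n) := by
    simp_rw [hX]
    rw [sum_comm, ← nsmul_eq_mul, ← sum_const]
    refine sum_congr rfl fun i _ => ?_
    rw [← card_powersetCard_filter_mem hn i, card_filter]
    push_cast
    rfl
  have h2 : ∑ T ∈ powersetCard n (univ : Finset (Fin N)), (#(T ∩ C) : ℝ) ^ 2
      ≤ #C * (n / N * N.choose n) + #C ^ 2 * ((n / N) ^ 2 * N.choose n) := by
    have e : ∀ T : Finset (Fin N), (#(T ∩ C) : ℝ) ^ 2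
        = ∑ i ∈ C, ∑ j ∈ C, if i ∈ T ∧ j ∈ T then 1 else 0 := by
      intro T
      rw [hX, sq, sum_mul_sum]
      refine sum_congr rfl fun i _ => sum_congr rfl fun j _ => ?_
      by_cases hi : i ∈ T <;> by_cases hj : j ∈ T <;> simp [hi, hj]
    simp_rw [e]
    rw [sum_comm, sum_congr rfl fun i _ => sum_comm]
    have hb : ∀ i ∈ C, ∀ j ∈ C, (∑ T ∈ powersetCard n (univ : Finset (Fin N)),
        if i ∈ T ∧ j ∈ T then (1 : ℝ) else 0)
        ≤ (if i = j then (n / N : ℝ) * (N.choose n : ℝ) else 0) + (n / N : ℝ) ^ 2 * N.choose n := by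
      intro i _ j _
      split_ifs with hij
      · subst hij
        rw [← card_powersetCard_filter_mem hn i, card_filter]
        simp only [and_self]
        push_cast
        exact le_add_of_nonneg_right (by positivity)
      · rw [zero_add]
        refine le_trans (le_of_eq ?_) (card_powersetCard_filter_mem_mem_le hnN hij)
        rw [card_filter]
        push_cast
        rfl
    refine (sum_le_sum fun i hi => sum_le_sum (hb i hi)).trans (le_of_eq ?_)
    simp only [sum_add_distrib, sum_const, sum_ite_eq, nsmul_eq_mul]
    rw [sum_congr rfl fun i hi => if_pos hi, sum_const, nsmul_eq_mul]
    ring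
  have e : ∀ T : Finset (Fin N), ((#(T ∩ C) : ℝ) - n * #C / N) ^ 2
      = (#(T ∩ C) : ℝ) ^ 2 - 2 * (n * #C / N) * #(T ∩ C) + (n * #C / N) ^ 2 := fun T => by ring
  simp_rw [e]
  rw [sum_add_distrib, sum_sub_distrib, ← mul_sum, h1, sum_const, card_powersetCard, card_univ,
    Fintype.card_fin, nsmul_eq_mul]
  refine (add_le_add_left (sub_le_sub_right h2 _) _).trans (le_of_eq ?_)
  ring

variable {Ω : Type*} [MeasurableSpace Ω] {μ : Measure Ω} {N n : ℕ}

/-- Chebyshev's inequality for the number of sampled nodes of a community. -/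
lemma IsSimpleRandomSample.measure_card_inter_lt_le {S : Ω → Finset (Fin N)}
    (hS : IsSimpleRandomSample μ S n) (hn : 1 ≤ n) (hnN : n ≤ N) {C : Finset (Fin N)}
    (hC : C.Nonempty) :
    μ {ω | (#(S ω ∩ C) : ℝ) < n * #C / N / 2} ≤ ENNReal.ofReal (4 / (n * #C / N)) := by
  classical
  set v : ℝ := n * #C / N with hv
  have hv₀ : 0 < v := by
    have : 0 < #C := hC.card_pos
    have : 0 < N := by omega
    positivity
  set 𝓕 := (powersetCard n (univ : Finset (Fin N))).filter fun T => (#(T ∩ C) : ℝ) < v / 2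
  have hch : (0 : ℝ) < N.choose n := by exact_mod_cast Nat.choose_pos hnN
  have hcard : (#𝓕 : ℝ) * (v ^ 2 / 4) ≤ v * N.choose n := by
    refine le_trans ?_ (sum_powersetCard_sq_le hn hnN C)
    rw [← nsmul_eq_mul, ← sum_const]
    refine (sum_le_sum fun T hT => ?_).trans
      (sum_le_sum_of_subset_of_nonneg (filter_subset _ _) fun _ _ _ => sq_nonneg _)
    have := (mem_filter.1 hT).2
    rw [← hv]
    nlinarith
  have hcard' : (#𝓕 : ℝ) / N.choose n ≤ 4 / v := by
    rw [div_le_div_iff₀ hch hv₀]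
    refine le_of_mul_le_mul_right ?_ (show 0 < v / 4 by positivity)
    linarith
  calc μ {ω | (#(S ω ∩ C) : ℝ) < v / 2} ≤ μ (⋃ T ∈ 𝓕, {ω | S ω = T}) := by
        refine measure_mono fun ω hω => ?_
        simp only [Set.mem_iUnion, exists_prop]
        exact ⟨S ω, by simpa [𝓕, hS.card ω] using hω, rfl⟩
    _ ≤ ∑ T ∈ 𝓕, μ {ω | S ω = T} := measure_biUnion_finset_le _ _
    _ = ∑ T ∈ 𝓕, ((N.choose n : ℕ) : ENNReal)⁻¹ :=
        sum_congr rfl fun T hT => hS.prob T (mem_powersetCard.1 (mem_filter.1 hT).1).2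
    _ = ENNReal.ofReal ((#𝓕 : ℝ) / N.choose n) := by
        rw [sum_const, nsmul_eq_mul, ENNReal.ofReal_div_of_pos hch, ENNReal.ofReal_natCast,
          ENNReal.ofReal_natCast, div_eq_mul_inv]
    _ ≤ _ := ENNReal.ofReal_le_ofReal hcard'

end

section

/-! ### Asymptotics -/

lemma exists_pos_le_sq_sqrt_sub {K₀ : ℕ} {Bt : Matrix (Fin K₀) (Fin K₀) ℝ}
    (hBt : Bt ∈ connMatrices K₀) (hassort : ∀ k l, l ≠ k → Bt k l < Bt k k) :
    ∃ δ : ℝ, 0 < δ ∧ ∀ a b, a ≠ b → δ ≤ (√(Bt a a) - √(Bt a b)) ^ 2 := by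
  rcases isEmpty_or_nonempty {p : Fin K₀ × Fin K₀ // p.1 ≠ p.2} with h | h
  · exact ⟨1, one_pos, fun a b hab => (h.false ⟨(a, b), hab⟩).elim⟩
  · obtain ⟨⟨⟨a, b⟩, hab⟩, hmin⟩ := Finite.exists_min
      fun p : {p : Fin K₀ × Fin K₀ // p.1 ≠ p.2} => (√(Bt p.1.1 p.1.1) - √(Bt p.1.1 p.1.2)) ^ 2
    refine ⟨_, ?_, fun a' b' h' => hmin ⟨(a', b'), h'⟩⟩
    have := Real.sqrt_lt_sqrt (hBt.2 a b).1.le (hassort a b hab.symm)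
    exact pow_pos (sub_pos.2 this) 2

/-- The size of the union bound. The polynomial factor is estimated crudely, as `2 ^ N * K ^ N`
already has exponential order. -/
lemma pow_mul_pow_mul_pow_le_exp (N K s : ℕ) :
    ((2 : ℝ) ^ N * (K ^ N * (((N : ℝ) ^ 2 + 1) * ((N : ℝ) ^ 2 + 1)) ^ s))
      ≤ Real.exp (N * (1 + K + 4 * s)) := by
  have h1 : (2 : ℝ) ^ N ≤ Real.exp (N * 1) := by
    rw [Real.exp_nat_mul]
    gcongr
    linarith [Real.add_one_le_exp 1]
  have h2 : (K : ℝ) ^ N ≤ Real.exp (N * K) := by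
    rw [Real.exp_nat_mul]
    gcongr
    linarith [Real.add_one_le_exp (K : ℝ)]
  have h3 : ((N : ℝ) ^ 2 + 1) * ((N : ℝ) ^ 2 + 1) ≤ Real.exp (4 * N) := by
    have h4 : (N : ℝ) ^ 2 + 1 ≤ Real.exp N ^ 2 := by
      have := pow_le_pow_left₀ (by positivity) (Real.add_one_le_exp (N : ℝ)) 2
      nlinarith [(Nat.cast_nonneg N : (0 : ℝ) ≤ N)]
    calc _ ≤ Real.exp N ^ 2 * Real.exp N ^ 2 := by gcongr
      _ = Real.exp (4 * N) := by
        rw [← pow_add, ← Real.exp_nat_mul]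
        norm_num
  have h5 : (((N : ℝ) ^ 2 + 1) * ((N : ℝ) ^ 2 + 1)) ^ s ≤ Real.exp (N * (4 * s)) := by
    calc _ ≤ Real.exp (4 * N) ^ s := by gcongr
      _ = _ := by rw [← Real.exp_nat_mul]; ring_nf
  calc _ ≤ Real.exp (N * 1) * (Real.exp (N * K) * Real.exp (N * (4 * s))) := by gcongr
    _ = _ := by
      rw [← Real.exp_add, ← Real.exp_add]
      ring_nf

lemma numPairs_le {N n : ℕ} : numPairs N n ≤ N * n := by
  unfold numPairs
  have : (0 : ℝ) ≤ n * (n + 1) / 2 := by positivity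
  linarith

variable {Ω : Type*} [MeasurableSpace Ω] {μ : Measure Ω} {N n K₀ : ℕ}

lemma IsSimpleRandomSample.measure_exists_card_lt_le {S : Ω → Finset (Fin N)}
    (hS : IsSimpleRandomSample μ S n) (hn : 1 ≤ n) (hnN : n ≤ N) {gs : Fin N → Fin K₀}
    {c : ℝ} (hc : 0 < c) (hgs : ∀ a, c * N ≤ communitySize gs a) :
    μ {ω | ∃ a, (#((S ω).filter fun i => gs i = a) : ℝ) < c * n / 2}
      ≤ ENNReal.ofReal (K₀ * (4 / (c * n))) := by
  classical
  have hN : (0 : ℝ) < N := by exact_mod_cast hn.trans hnN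
  have hone : ∀ a, μ {ω | (#((S ω).filter fun i => gs i = a) : ℝ) < c * n / 2}
      ≤ ENNReal.ofReal (4 / (c * n)) := by
    intro a
    set C := univ.filter fun i => gs i = a with hC
    have hCc : c * N ≤ #C := hgs a
    have hne : C.Nonempty := by
      rw [← card_pos]
      exact_mod_cast (mul_pos hc hN).trans_le hCc
    have hle : c * n ≤ n * #C / N := by
      rw [le_div_iff₀ hN]
      nlinarith [(Nat.cast_nonneg n : (0 : ℝ) ≤ n)]
    have hn' : (0 : ℝ) < n := by exact_mod_cast hn
    refine (measure_mono fun ω hω => ?_).trans ((hS.measure_card_inter_lt_le hn hnN hne).trans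
      (ENNReal.ofReal_le_ofReal (div_le_div_of_nonneg_left (by norm_num) (by positivity) hle)))
    have e : S ω ∩ C = (S ω).filter fun i => gs i = a := by
      ext i
      simp [hC]
    simp only [Set.mem_ofPred_eq, e] at hω ⊢
    linarith
  calc _ ≤ μ (⋃ a, {ω | (#((S ω).filter fun i => gs i = a) : ℝ) < c * n / 2}) :=
        measure_mono fun ω hω => Set.mem_iUnion.2 hω
    _ ≤ ∑ a, μ {ω | (#((S ω).filter fun i => gs i = a) : ℝ) < c * n / 2} :=
        measure_iUnion_fintype_le _ _
    _ ≤ ∑ _a : Fin K₀, ENNReal.ofReal (4 / (c * n)) := sum_le_sum fun a _ => hone a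
    _ = _ := by
      rw [sum_const, nsmul_eq_mul, ENNReal.ofReal_mul (by positivity)]
      simp

/-- Non-asymptotic bound for the probability that the log-likelihood ratio is not strongly
negative. -/
lemma measure_lt_logLikRatio_le [IsProbabilityMeasure μ] {K : ℕ} (hK : 1 ≤ K) (hKK₀ : K < K₀)
    {Bt : Matrix (Fin K₀) (Fin K₀) ℝ} {δ c ρ : ℝ} (hδ₀ : 0 ≤ δ)
    (hδ : ∀ a b, a ≠ b → δ ≤ (√(Bt a a) - √(Bt a b)) ^ 2) (hc : 0 < c) (hρ : 0 < ρ)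
    {gs : Fin N → Fin K₀} (hgs : ∀ a, c * N ≤ communitySize gs a)
    (hn : 1 ≤ n) (hnN : n ≤ N) (hnK : 4 * K ≤ c * n)
    {A : Ω → Matrix (Fin N) (Fin N) ℝ} (hA : IsSBM μ A gs (ρ • Bt))
    {S : Ω → Finset (Fin N)} (hS : IsSimpleRandomSample μ S n) :
    μ {ω | -(c ^ 2 * δ / (32 * K ^ 2) * (ρ * numPairs N n))
        < logLikRatio (A ω) (S ω) K gs (ρ • Bt)}
      ≤ ENNReal.ofReal (K₀ * (4 / (c * n))) + ENNReal.ofReal (Real.exp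
        (N * (1 + K + 4 * Fintype.card (Sym2 (Fin K)) - c ^ 2 * δ / (64 * K ^ 2) * (ρ * n)))) := by
  have hK' : (0 : ℝ) < K := by positivity
  set D := c ^ 2 * δ / (32 * K ^ 2) with hD
  have hD₀ : 0 ≤ D := by positivity
  let 𝒮 : Set (Finset (Fin N)) := {T | ∀ a, c * n / 2 ≤ #(T.filter fun i => gs i = a)}
  have hd : ∀ T ∈ 𝒮, ∀ (g : Fin N → Fin K) (θ : Fin K → Fin K → ℝ), (∀ k l, θ k l = θ l k) →
      2 * (D * (ρ * (N * n))) ≤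
        ∑ p ∈ pairs T, (θ (g p.1) (g p.2) - √((ρ • Bt) (gs p.1) (gs p.2))) ^ 2 := by
    -- With `r = c N / K`, `m = c n / (4 K)` and separation `ρ δ`, the product `r * m * (ρ δ) / 4`
    -- equals `2 D ρ N n`. Half of it is used as threshold `x`, which leaves the exponent `-D ρ N n
    -- / 2`.
    intro T hT g θ hθ
    refine le_trans (le_of_eq ?_) (le_sum_pairs_sq_sub hK hKK₀ T gs g
      (β := fun a b => √((ρ • Bt) a b)) (fun a b => by rw [hA.conn.1.apply]) hθ
      (δ := ρ * δ) (r := c * N / K) (m := c * n / (4 * K)) (by positivity) (by positivity)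
      ?_ ?_ ?_)
    · rw [hD]
      field_simp
      ring
    · intro a b hab
      simp only [Matrix.smul_apply, smul_eq_mul, Real.sqrt_mul hρ.le]
      have h1 := mul_le_mul_of_nonneg_left (hδ a b hab) hρ.le
      have h2 := Real.sq_sqrt hρ.le
      calc ρ * δ ≤ ρ * (√(Bt a a) - √(Bt a b)) ^ 2 := h1
        _ = (√ρ) ^ 2 * (√(Bt a a) - √(Bt a b)) ^ 2 := by rw [h2]
        _ = _ := by ring
    · intro a
      rw [mul_div_cancel₀ _ hK'.ne']
      exact hgs a
    · intro a
      have := hT a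
      -- By `hnK` the extra `K` is at most `c * n / 4`, so the total stays below `c * n / 2`.
      have e : (K : ℝ) * (c * n / (4 * K) + 1) = c * n / 4 + K := by field_simp
      rw [e]
      linarith
  have hbad := hS.measure_exists_card_lt_le hn hnN hc hgs
  have hmain := hA.measure_exists_lt_logLikRatio_le hK 𝒮 (x := D * (ρ * (N * n))) hd
  refine le_trans (measure_mono ?_) ((measure_union_le _ _).trans (add_le_add hbad
    (hmain.trans (ENNReal.ofReal_le_ofReal ?_))))
  · intro ω hω
    by_cases h : S ω ∈ 𝒮
    · refine Or.inr ⟨S ω, h, lt_of_le_of_lt ?_ hω⟩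
      have := numPairs_le (N := N) (n := n)
      gcongr
    · left
      simpa [𝒮] using h
  · refine (mul_le_mul_of_nonneg_right (pow_mul_pow_mul_pow_le_exp N K _)
      (Real.exp_pos _).le).trans (le_of_eq ?_)
    rw [← Real.exp_add, hD]
    congr 1
    ring

end

end SubsampledSBM

end

/-! ### Passage to the limit -/

theorem theorem1
    (K₀ K : ℕ) (hK : 1 ≤ K) (hKK₀ : K < K₀)
    -- the rescaled connectivity matrix, constant in `N`
    (Bt : Matrix (Fin K₀) (Fin K₀) ℝ)
    (hBt : Bt ∈ SubsampledSBM.connMatrices K₀)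
    (hassort : ∀ k l, l ≠ k → Bt k l < Bt k k)
    -- the network density
    (ρ : ℕ → ℝ)
    (hρ_zero : Tendsto ρ atTop (𝓝 0))
    (hρ_rate : Tendsto (fun N : ℕ => ρ N * (N : ℝ) / Real.log (N : ℝ)) atTop atTop)
    -- the true labels, with balanced communities
    (gs : ∀ N : ℕ, Fin N → Fin K₀)
    (hbalance : ∃ c : ℝ, 0 < c ∧ ∀ᶠ N : ℕ in atTop, ∀ k : Fin K₀,
      c * (N : ℝ) ≤ (SubsampledSBM.communitySize (gs N) k : ℝ))
    -- the subsample size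
    (n : ℕ → ℕ) (hn_le : ∀ N, n N ≤ N)
    (hn : ∃ c : ℝ, 0 < c ∧ ∀ᶠ N : ℕ in atTop, c * (Real.log (N : ℝ) / ρ N) ≤ (n N : ℝ))
    -- the network and the sampled nodes
    (Ω : ℕ → Type*) [∀ N, MeasurableSpace (Ω N)]
    (μ : ∀ N, Measure (Ω N)) [∀ N, IsProbabilityMeasure (μ N)]
    (A : ∀ N, Ω N → Matrix (Fin N) (Fin N) ℝ)
    (hA : ∀ N, SubsampledSBM.IsSBM (μ N) (A N) (gs N) (ρ N • Bt))
    (S : ∀ N, Ω N → Finset (Fin N))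
    (hS : ∀ N, SubsampledSBM.IsSimpleRandomSample (μ N) (S N) (n N))
    (hAS : ∀ N, IndepFun
      (fun ω => ((fun i j => A N ω i j) : Fin N → Fin N → ℝ)) (S N) (μ N)) :
    ∃ C : ℝ, 0 < C ∧
      Tendsto
        (fun N : ℕ => μ N {ω | SubsampledSBM.logLikRatio (A N ω) (S N ω) K (gs N) (ρ N • Bt)
          ≤ -(C * (ρ N * SubsampledSBM.numPairs N (n N)))})
        atTop (𝓝 1) := by
  obtain ⟨δ, hδ₀, hδ⟩ := SubsampledSBM.exists_pos_le_sq_sqrt_sub hBt hassort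
  obtain ⟨c, hc, hgs⟩ := hbalance
  obtain ⟨c', hc', hn⟩ := hn
  have hK' : (0 : ℝ) < K := by positivity
  have hρ : ∀ N, 0 < ρ N := by
    intro N
    have k : Fin K₀ := ⟨0, by omega⟩
    have h1 := ((hA N).conn.2 k k).1
    rw [Matrix.smul_apply, smul_eq_mul] at h1
    exact pos_of_mul_pos_left h1 (hBt.2 k k).1.le
  have hlog : Tendsto (fun N : ℕ => Real.log (N : ℝ)) atTop atTop :=
    Real.tendsto_log_atTop.comp tendsto_natCast_atTop_atTop
  have hn_top : Tendsto (fun N => (n N : ℝ)) atTop atTop := by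
    refine tendsto_atTop_mono' atTop ?_ (hlog.const_mul_atTop hc')
    -- Once `ρ N < 1`, the sample size is at least `c' * log N`.
    filter_upwards [hn, hρ_zero.eventually (gt_mem_nhds one_pos), hlog.eventually_ge_atTop 0]
      with N hN hρN hlogN
    refine le_trans ?_ hN
    gcongr
    rw [le_div_iff₀ (hρ N)]
    nlinarith
  set D := c ^ 2 * δ / (64 * K ^ 2) with hD
  have hD₀ : 0 < D := by positivity
  refine ⟨c ^ 2 * δ / (32 * K ^ 2), by positivity, ?_⟩
  set u : ℕ → ENNReal := fun N =>
    ENNReal.ofReal (K₀ * (4 / (c * n N))) + ENNReal.ofReal (Real.exp (-(N : ℝ)))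
  have hu : Tendsto u atTop (𝓝 0) := by
    have h1 : Tendsto (fun N => (K₀ : ℝ) * (4 / (c * n N))) atTop (𝓝 0) := by
      simpa using ((hn_top.const_mul_atTop hc).const_div_atTop 4).const_mul (K₀ : ℝ)
    have h2 : Tendsto (fun N : ℕ => Real.exp (-(N : ℝ))) atTop (𝓝 0) :=
      Real.tendsto_exp_neg_atTop_nhds_zero.comp tendsto_natCast_atTop_atTop
    simpa only [ENNReal.ofReal_zero, add_zero] using
      (ENNReal.tendsto_ofReal h1).add (ENNReal.tendsto_ofReal h2)
  have hlow : ∀ᶠ N in atTop, 1 - u N ≤ μ N {ω | SubsampledSBM.logLikRatio (A N ω) (S N ω) K (gs N)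
      (ρ N • Bt) ≤ -(c ^ 2 * δ / (32 * K ^ 2) * (ρ N * SubsampledSBM.numPairs N (n N)))} := by
    filter_upwards [hgs, hn, hn_top.eventually_ge_atTop 1,
      (hn_top.const_mul_atTop hc).eventually_ge_atTop (4 * K : ℝ),
      (hlog.const_mul_atTop (mul_pos hD₀ hc')).eventually_ge_atTop
        (2 + K + 4 * Fintype.card (Sym2 (Fin K)) : ℝ)] with N hgsN hnN h1 h4 hlogN
    have hb := SubsampledSBM.measure_lt_logLikRatio_le hK hKK₀ hδ₀.le hδ hc (hρ N) hgsN
      (by exact_mod_cast h1) (hn_le N) h4 (hA N) (hS N)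
    have hexp : ENNReal.ofReal (Real.exp (N * (1 + K + 4 * Fintype.card (Sym2 (Fin K))
        - c ^ 2 * δ / (64 * K ^ 2) * (ρ N * n N)))) ≤ ENNReal.ofReal (Real.exp (-(N : ℝ))) := by
      refine ENNReal.ofReal_le_ofReal (Real.exp_le_exp.2 ?_)
      have h5 : c' * Real.log N ≤ ρ N * n N := by
        rw [← mul_div_assoc, div_le_iff₀ (hρ N)] at hnN
        linarith
      have h6 := mul_le_mul_of_nonneg_left h5 hD₀.le
      -- The threshold `2 + K + ...` for `D * c' * log N` exceeds the entropy constant by 1, which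
      -- leaves the bound `exp (-N)`.
      have h7 : 1 + K + 4 * Fintype.card (Sym2 (Fin K)) - D * (ρ N * n N) ≤ -1 := by linarith
      have := mul_le_mul_of_nonneg_left h7 (Nat.cast_nonneg N : (0 : ℝ) ≤ N)
      linarith
    -- Subadditivity over the event and its complement replaces the complement rule, so the event
    -- need not be shown measurable.
    rw [tsub_le_iff_right, ← measure_univ (μ := μ N)]
    refine (measure_mono fun ω _ => ?_).trans ((measure_union_le _ _).trans
      (add_le_add_right (hb.trans (add_le_add_right hexp _)) _))
    simpa only [Set.mem_union, Set.mem_ofPred_eq] using le_or_gt _ _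
  refine tendsto_of_tendsto_of_tendsto_of_le_of_le' ?_ tendsto_const_nhds hlow
    (Eventually.of_forall fun N => prob_le_one)
  simpa using ENNReal.Tendsto.sub (tendsto_const_nhds (x := (1 : ENNReal))) hu
    (Or.inl ENNReal.one_ne_top)
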